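/- Let $\mathbb{F}$ be a skew field, and let $\mathbb{F}(t)$ be the skew field of rational functions over $\mathbb{F}$, that is, the Ore quotient ring of the polynomial ring $\mathbb{F}[t]$ in an indeterminate $t$ commuting with $\mathbb{F}$. Put $\deg (p/q) := \deg p - \deg q$ and $\deg 0 := -\infty$, and let $\mathbb{F}(t)^-$ be the ring of all $u \in \mathbb{F}(t)$ with $\deg u \le 0$. For $n \ge 0$ let $\mathcal{L}_{\rm L}(\mathbb{F}(t)^n)$ be the family of all full-rank (rank $n$) free submodules of $\mathbb{F}(t)^n$, regarded as a left $\mathbb{F}(t)^-$-module of row vectors, and let $\mathcal{L}_{\rm R}(\mathbb{F}(t)^n)$ be the family of all full-rank free submodules of $\mathbb{F}(t)^n$, regarded as a right $\mathbb{F}(t)^-$-module of column vectors, both ordered by inclusion. Let $\check{\mathcal{L}}_{\rm R}(\mathbb{F}(t)^n)$ be the latter with the reversed order. A *uniform modular lattice* is a modular lattice $\mathcal{L}$, in which every chain of every interval is finite, such that the ascending operator $(x)^+ := \bigvee \{ y \in \mathcal{L} \mid y \text{ covers } x\}$ is defined for all $x$ and is an automorphism of $\mathcal{L}$. A function $g :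 \mathcal{L} \to \mathbb{R} \cup \{\infty\}$, not identically $\infty$, on a uniform modular lattice is *L-convex* if $g(x) + g(y) \ge g(x \wedge y) + g(x \vee y)$ for all $x, y \in \mathcal{L}$, and there is $\alpha \in \mathbb{R}$ such that $g((x)^+) = g(x) + \alpha$ for all $x \in \mathcal{L}$. Let $A \in \mathbb{F}(t)^{n \times n}$. Then $\mathcal{L}_{\rm L}(\mathbb{F}(t)^n) \times \check{\mathcal{L}}_{\rm R}(\mathbb{F}(t)^n)$, with the product order, is a uniform modular lattice with ascending operator $(L, M) \mapsto (tL, t^{-1}M)$; the maximum $$\deg A(L,M) := \max \{ \deg (xAy) \mid x \in L,\ y \in M \} \in \mathbb{Z} \cup \{-\infty\}$$ exists for all $L \in \mathcal{L}_{\rm L}(\mathbb{F}(t)^n)$ and $M \in \mathcal{L}_{\rm R}(\mathbb{F}(t)^n)$; and the function $(L,M) \mapsto \infty \cdot \deg A(L,M)$ is L-convex on $\mathcal{L}_{\rm L}(\mathbb{F}(t)^n) \times \check{\mathcal{L}}_{\rm R}(\mathbb{F}(t)^n)$, where $\infty \cdot c$ is defined as $\infty$ if $c > 0$ and as $0$ if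 $c \le 0$. -/

import Mathlib

open Polynomial

namespace SkewRat

section RationalFunctions

variable {F : Type*} [DivisionRing F]

/-- Division with remainder in `F[t]`, quotient on the left. -/
theorem exists_eq_mul_add (s : F[X]) (hs : s ≠ 0) (r : F[X]) :
    ∃ q ρ : F[X], r = q * s + ρ ∧ ρ.degree < s.degree := by
  induction hn : r.natDegree using Nat.strong_induction_on generalizing r with
  | _ n ih =>
  by_cases hlt : r.degree < s.degree
  · exact ⟨0, r, by simp, hlt⟩
  push Not at hlt
  have hr : r ≠ 0 := by
    rintro rfl
    simp [hs] at hlt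
  have hnat : s.natDegree ≤ r.natDegree := natDegree_le_natDegree hlt
  set c : F := r.leadingCoeff * s.leadingCoeff⁻¹ with hc
  have hls : s.leadingCoeff ≠ 0 := leadingCoeff_ne_zero.2 hs
  have hlr : r.leadingCoeff ≠ 0 := leadingCoeff_ne_zero.2 hr
  have hc0 : c ≠ 0 := mul_ne_zero hlr (inv_ne_zero hls)
  set m : F[X] := monomial (r.natDegree - s.natDegree) c with hm
  have hm0 : m ≠ 0 := by simpa [hm] using hc0
  have hdeg : r.degree = (m * s).degree := by
    rw [degree_eq_natDegree hr, degree_eq_natDegree (mul_ne_zero hm0 hs),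
      natDegree_mul hm0 hs, hm, natDegree_monomial_eq _ hc0, Nat.sub_add_cancel hnat]
  have hlc : r.leadingCoeff = (m * s).leadingCoeff := by
    rw [leadingCoeff_mul, hm, leadingCoeff_monomial, hc, mul_assoc, inv_mul_cancel₀ hls, mul_one]
  have hsub : (r - m * s).degree < r.degree := degree_sub_lt_left hdeg hr hlc
  by_cases h0 : r - m * s = 0
  · refine ⟨m, 0, by rw [add_zero]; exact sub_eq_zero.1 h0, ?_⟩
    rw [degree_zero]
    exact bot_lt_iff_ne_bot.2 (fun h => hs (degree_eq_bot.1 h))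
  · obtain ⟨q, ρ, h1, h2⟩ := ih _ (hn ▸ natDegree_lt_natDegree h0 hsub) (r - m * s) rfl
    refine ⟨q + m, ρ, ?_, h2⟩
    rw [add_mul, add_right_comm, ← h1, sub_add_cancel]

/-- `F[t]` is a (left) Ore domain. -/
theorem exists_ore (s : F[X]) (hs : s ≠ 0) (r : F[X]) :
    ∃ u v : F[X], u ≠ 0 ∧ u * r = v * s := by
  induction hn : s.natDegree using Nat.strong_induction_on generalizing s r with
  | _ n ih =>
  obtain ⟨q, ρ, h1, h2⟩ := exists_eq_mul_add s hs r
  by_cases hρ : ρ = 0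
  · exact ⟨1, q, one_ne_zero, by rw [h1, hρ, add_zero, one_mul]⟩
  obtain ⟨u, v, hu, huv⟩ := ih _ (hn ▸ natDegree_lt_natDegree hρ h2) ρ hρ s rfl
  refine ⟨v, u + v * q, ?_, ?_⟩
  · rintro rfl
    rw [zero_mul] at huv
    exact mul_ne_zero hu hs huv
  · rw [h1, mul_add, add_mul, huv, mul_assoc, add_comm]

noncomputable instance instOreSet : OreLocalization.OreSet (nonZeroDivisors F[X]) :=
  (OreLocalization.nonempty_oreSet_iff_of_noZeroDivisors.2 fun r s => by
    obtain ⟨u, v, hu, h⟩ := exists_ore (s : F[X]) (nonZeroDivisors.coe_ne_zero s) r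
    exact ⟨v, ⟨u, mem_nonZeroDivisors_of_ne_zero hu⟩, h⟩).some

variable (F) in
/-- The skew field `F(t)`: the Ore quotient ring of `F[t]`, where `t` commutes with `F`. -/
def RatFun : Type _ := OreLocalization (nonZeroDivisors F[X]) F[X]

noncomputable instance : DivisionRing (RatFun F) :=
  inferInstanceAs (DivisionRing (OreLocalization (nonZeroDivisors F[X]) F[X]))

namespace RatFun

/-- The embedding `p ↦ p/1` of `F[t]` into `F(t)`. -/
noncomputable def ofPoly : F[X] →+* RatFun F :=
  OreLocalization.numeratorRingHom (S := nonZeroDivisors F[X])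

variable (F) in
/-- The indeterminate, as an element of `F(t)`. -/
noncomputable def t : RatFun F := ofPoly X

/-- `deg p - deg q` for a fraction with numerator `p` and denominator `q`; `-∞` if `p = 0`. -/
noncomputable def degAux (p : F[X]) (q : nonZeroDivisors F[X]) : WithBot ℤ :=
  open Classical in
  if p = 0 then ⊥ else (((p.natDegree : ℤ) - ((q : F[X]).natDegree : ℤ) : ℤ) : WithBot ℤ)

/-- The degree of a rational function: `deg (p/q) = deg p - deg q`, and `deg 0 = -∞`. Elements of
the Ore localization are written as `q⁻¹ p`; see `deg_ofPoly_div` for fractions `p q⁻¹`. -/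
noncomputable def deg : RatFun F → WithBot ℤ :=
  OreLocalization.liftExpand degAux (by
    intro r u s hs
    have hne := nonZeroDivisors.ne_zero hs
    have hu : u ≠ 0 := left_ne_zero_of_mul hne
    have hs0 : (s : F[X]) ≠ 0 := right_ne_zero_of_mul hne
    by_cases hr : r = 0
    · simp [degAux, hr]
    · simp only [degAux, hr, smul_eq_mul, mul_eq_zero, hu, or_self, if_false,
        natDegree_mul hu hr, natDegree_mul hu hs0]
      congr 1
      push_cast
      ring)

theorem deg_oreDiv (p : F[X]) (q : nonZeroDivisors F[X]) :
    deg (OreLocalization.oreDiv p q : RatFun F) = degAux p q := rfl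

theorem exists_oreDiv (x : RatFun F) :
    ∃ (p : F[X]) (q : nonZeroDivisors F[X]), x = OreLocalization.oreDiv p q := by
  induction x using OreLocalization.ind with
  | _ p q => exact ⟨p, q, rfl⟩

theorem deg_ofPoly (p : F[X]) (hp : p ≠ 0) : deg (ofPoly p) = ((p.natDegree : ℤ) : WithBot ℤ) := by
  change degAux p 1 = _
  simp [degAux, hp]

theorem deg_zero : deg (0 : RatFun F) = ⊥ := by
  rw [← map_zero (ofPoly (F := F))]
  change degAux (0 : F[X]) 1 = _
  simp [degAux]

theorem deg_one : deg (1 : RatFun F) = 0 := by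
  rw [← map_one (ofPoly (F := F)), deg_ofPoly 1 one_ne_zero]
  simp

theorem deg_mul (x y : RatFun F) : deg (x * y) = deg x + deg y := by
  obtain ⟨r₁, s₁, rfl⟩ := exists_oreDiv x
  obtain ⟨r₂, s₂, rfl⟩ := exists_oreDiv y
  obtain ⟨u, v, hu, h⟩ := exists_ore (s₂ : F[X]) (nonZeroDivisors.coe_ne_zero s₂) r₁
  have hmul := OreLocalization.oreDiv_mul_char r₁ r₂ s₁ s₂ v
    ⟨u, mem_nonZeroDivisors_of_ne_zero hu⟩ h
  have hs₁ := nonZeroDivisors.coe_ne_zero s₁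
  have hs₂ := nonZeroDivisors.coe_ne_zero s₂
  refine (congrArg deg hmul).trans ?_
  simp only [deg_oreDiv]
  by_cases h₁ : r₁ = 0
  · have hv : v = 0 := by
      rw [h₁, mul_zero] at h
      exact (mul_eq_zero.1 h.symm).resolve_right hs₂
    simp [degAux, h₁, hv]
  by_cases h₂ : r₂ = 0
  · simp [degAux, h₂]
  have hv : v ≠ 0 := by
    rintro rfl
    rw [zero_mul] at h
    exact mul_ne_zero hu h₁ h
  have hd := congrArg natDegree h
  rw [natDegree_mul hu h₁, natDegree_mul hv hs₂] at hd
  simp only [degAux, h₁, h₂, hv, mul_eq_zero, or_self, if_false, Submonoid.coe_mul,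
    natDegree_mul hv h₂, natDegree_mul hu hs₁]
  rw [← WithBot.coe_add]
  congr 1
  push_cast
  omega

theorem deg_add_le (x y : RatFun F) : deg (x + y) ≤ max (deg x) (deg y) := by
  obtain ⟨r₁, s₁, rfl⟩ := exists_oreDiv x
  obtain ⟨r₂, s₂, rfl⟩ := exists_oreDiv y
  obtain ⟨u, v, hu, h⟩ := exists_ore (s₂ : F[X]) (nonZeroDivisors.coe_ne_zero s₂) (s₁ : F[X])
  have hadd := OreLocalization.oreDiv_add_char (r := r₁) (r' := r₂) s₁ s₂ v
    ⟨u, mem_nonZeroDivisors_of_ne_zero hu⟩ h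
  have hs₁ := nonZeroDivisors.coe_ne_zero s₁
  have hs₂ := nonZeroDivisors.coe_ne_zero s₂
  refine (congrArg deg hadd).trans_le ?_
  simp only [deg_oreDiv, Submonoid.smul_def, smul_eq_mul]
  have hv : v ≠ 0 := by
    rintro rfl
    rw [zero_mul] at h
    exact mul_ne_zero hu hs₁ h
  have hd := congrArg natDegree h
  rw [natDegree_mul hu hs₁, natDegree_mul hv hs₂] at hd
  by_cases h₁ : r₁ = 0
  · by_cases h₂ : r₂ = 0
    · simp [degAux, h₁, h₂]
    · simp only [degAux, h₁, h₂, hv, mul_zero, zero_add, mul_eq_zero, or_self, if_false, if_true,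
        Submonoid.coe_mul, natDegree_mul hv h₂, natDegree_mul hu hs₁]
      refine le_max_of_le_right (WithBot.coe_le_coe.2 ?_)
      push_cast
      omega
  by_cases h₂ : r₂ = 0
  · simp only [degAux, h₁, h₂, hu, mul_zero, add_zero, mul_eq_zero, or_self, if_false, if_true,
      Submonoid.coe_mul, natDegree_mul hu h₁, natDegree_mul hu hs₁]
    refine le_max_of_le_left (WithBot.coe_le_coe.2 ?_)
    push_cast
    omega
  by_cases h₀ : u * r₁ + v * r₂ = 0
  · simp [degAux, h₀]
  simp only [degAux, h₀, h₁, h₂, if_false, Submonoid.coe_mul, natDegree_mul hu hs₁]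
  have hle := natDegree_add_le (u * r₁) (v * r₂)
  rw [natDegree_mul hu h₁, natDegree_mul hv h₂] at hle
  rw [← WithBot.coe_max]
  refine WithBot.coe_le_coe.2 ?_
  push_cast
  omega

theorem deg_neg (x : RatFun F) : deg (-x) = deg x := by
  have h1 : deg (-1 : RatFun F) = 0 := by
    rw [← map_one (ofPoly (F := F)), ← map_neg, deg_ofPoly (-1 : F[X]) (neg_ne_zero.2 one_ne_zero)]
    simp
  rw [← neg_one_mul, deg_mul, h1, zero_add]

/-- For `p, q ≠ 0` the fraction `p/q = p q⁻¹` has degree `deg p - deg q`. -/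
theorem deg_ofPoly_div (p q : F[X]) (hp : p ≠ 0) (hq : q ≠ 0) :
    deg (ofPoly p / ofPoly q) = (((p.natDegree : ℤ) - (q.natDegree : ℤ) : ℤ) : WithBot ℤ) := by
  have hq' : (ofPoly q : RatFun F) ≠ 0 := by
    intro h
    have := deg_ofPoly q hq
    rw [h, deg_zero] at this
    exact WithBot.bot_ne_coe this
  have h := deg_mul (ofPoly p / ofPoly q) (ofPoly q)
  rw [div_mul_cancel₀ _ hq', deg_ofPoly p hp, deg_ofPoly q hq] at h
  generalize deg (ofPoly p / ofPoly q) = d at h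
  induction d using WithBot.recBotCoe with
  | bot => simp at h
  | coe d =>
    rw [← WithBot.coe_add, WithBot.coe_inj] at h
    rw [WithBot.coe_inj]
    omega

variable (F) in
/-- The ring `F(t)⁻` of proper elements, those of degree at most `0`. -/
noncomputable def proper : Subring (RatFun F) where
  carrier := {x | deg x ≤ 0}
  zero_mem' := by simp [deg_zero]
  one_mem' := by simp [deg_one]
  add_mem' := fun {x y} hx hy => (deg_add_le x y).trans (max_le hx hy)
  mul_mem' := fun {x y} hx hy => by
    change deg (x * y) ≤ 0
    rw [deg_mul]
    exact add_nonpos hx hy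
  neg_mem' := fun {x} hx => by
    change deg (-x) ≤ 0
    rw [deg_neg]
    exact hx

end RatFun

open RatFun

variable (F) in
/-- `ℒ_L(F(t)ⁿ)`: the submodules of the left `F(t)⁻`-module `F(t)ⁿ` of row vectors that are free
of full rank `n`, ordered by inclusion. -/
abbrev LatL (n : ℕ) : Type _ :=
  {L : Submodule (proper F) (Fin n → RatFun F) // Nonempty (Module.Basis (Fin n) (proper F) L)}

variable (F) in
/-- `ℒ_R(F(t)ⁿ)`: the submodules of the right `F(t)⁻`-module `F(t)ⁿ` of column vectors that are
free of full rank `n`, ordered by inclusion. A right module is a left module over the opposite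
ring, which acts by `op a • v = v a`. -/
abbrev LatR (n : ℕ) : Type _ :=
  {M : Submodule (proper F).op (Fin n → RatFun F) //
    Nonempty (Module.Basis (Fin n) (proper F).op M)}

/-- The set `A(L, M)` of all `x A y` with `x ∈ L` and `y ∈ M`. -/
def valueSet {n : ℕ} (A : Matrix (Fin n) (Fin n) (RatFun F)) (L : LatL F n) (M : LatR F n) :
    Set (RatFun F) :=
  {u | ∃ x ∈ L.1, ∃ y ∈ M.1, u = x ⬝ᵥ A.mulVec y}

/-- `deg A(L, M)`: the maximum of `deg u` over `u ∈ A(L, M)`. -/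
noncomputable def degOn {n : ℕ} (A : Matrix (Fin n) (Fin n) (RatFun F))
    (L : LatL F n) (M : LatR F n) : WithBot ℤ :=
  sSup (deg '' valueSet A L M)

end RationalFunctions

/-- `∞ · c`: it is `∞` if `c > 0`, and `0` if `c ≤ 0`. -/
noncomputable def inftyMul (c : WithBot ℤ) : WithTop ℝ :=
  open Classical in if 0 < c then ⊤ else 0

section Lattices

variable {P : Type*} [PartialOrder P]

/-- The ascending operator as a relation: `y = (x)⁺` is the join of all elements covering `x`. -/
def IsAscent (x y : P) : Prop := IsLUB {z | x ⋖ z} y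

variable (P) in
/-- Uniform modular lattices: modular lattices in which the ascending operator is defined
everywhere and is an automorphism; chains in intervals are required to be finite. -/
structure IsUniformModularLattice : Prop where
  exists_join : ∀ x y : P, ∃ j, IsLUB {x, y} j
  exists_meet : ∀ x y : P, ∃ m, IsGLB {x, y} m
  /-- `x ∨ (y ∧ z) = (x ∨ y) ∧ z` whenever `x ≤ z` -/
  modular : ∀ x y z yz xy a b : P, x ≤ z → IsGLB {y, z} yz → IsLUB {x, yz} a →
    IsLUB {x, y} xy → IsGLB {xy, z} b → a = b
  chain_finite : ∀ (x y : P) (C : Set P), C ⊆ Set.Icc x y → IsChain (· ≤ ·) C → C.Finite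
  ascent : ∃ e : P ≃o P, ∀ x, IsAscent x (e x)

/-- L-convexity of a function `g : P → ℝ ∪ {∞}` on a uniform modular lattice `P`, for functions
that are not identically `∞`. -/
structure IsLConvex (g : P → WithTop ℝ) : Prop where
  exists_lt_top : ∃ x, g x < ⊤
  sub : ∀ x y m j : P, IsGLB {x, y} m → IsLUB {x, y} j → g m + g j ≤ g x + g y
  lin : ∃ α : ℝ, ∀ x y : P, IsAscent x y → g y = g x + (α : WithTop ℝ)

end Lattices

end SkewRat

/-!
Both sides of the product are treated at once. `F(t)⁻` is a discrete valuation ring with a central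
uniformizer `t⁻¹` (`IsCentralPole`), and so is its opposite ring; the right module of columns is a
left module over the latter. Let `O` be such a ring in a skew field `D`, with `τ` the inverse of the
uniformizer, and let `V` be an `n`-dimensional left vector space over `D`.

A submodule `L` of `V` is free of rank `n` if and only if it is full and bounded
(`nonempty_basis_iff`): every vector is moved into `L` by some power of `τ⁻¹`, and some power of
`τ⁻¹` moves all of `L` into the standard lattice. From left to right one clears denominators; from
right to left one takes an echelon basis, whose pivots are powers of `τ` with the largest possible
exponent (`le_span_of_pivot`). This criterion is visibly stable under sums, intersections and
scaling by `τ`, and under passing to a submodule between two lattices, so the lattices form a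
modular lattice. The sum of the pivot exponents is strictly monotone (`sum_pivot_lt`), so that
chains in intervals are finite.

If `N` covers `L`, then Nakayama's lemma gives `τ⁻¹ N ⊆ L`; conversely `L + O u` covers `L` for
each `u ∈ τ L` outside `L`. Hence the join of the covers is `τ L` (`isLUB_covBy`). Since the second
factor carries the reversed order, the dual fact is needed as well: the meet of the lattices covered
by `L` is `τ⁻¹ L` (`isGLB_covBy`). For this, Zorn's lemma gives a submodule between `τ⁻¹ L` and `L`
that is maximal among those avoiding a given element of `L` outside `τ⁻¹ L`.

The values `x A y` on `L × M` have bounded degree, so the maximum exists. The function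
`∞ · deg A(L, M)` is `0` exactly if all these values are proper, and additivity of `x A y` in `x`
and in `y` carries this from `(L, M)` and `(L', M')` to `(L ∩ L', M + M')` and `(L + L', M ∩ M')`.
As `t` is central, `A(t L, t⁻¹ M) = A(L, M)`, so that the slope along the ascending operator is `0`.
-/

set_option linter.unusedSectionVars false

namespace CentralPole

/-! ### Valuation rings with a central uniformizer -/

/-- `O` is a discrete valuation ring of the skew field `D` with a central uniformizer, and `τ` is
the inverse of that uniformizer. For `O = F(t)⁻` one takes `τ = t`; the notion is invariant under
passing to opposite rings, so that it covers left and right modules alike. -/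
structure IsCentralPole {D : Type*} [DivisionRing D] (O : Subring D) (τ : D) : Prop where
  commute : ∀ x, Commute τ x
  inv_mem : τ⁻¹ ∈ O
  notMem : τ ∉ O
  exists_unit : ∀ x : D, x ≠ 0 → ∃ k : ℤ, x * τ ^ k ∈ O ∧ (x * τ ^ k)⁻¹ ∈ O

variable {D : Type*} [DivisionRing D] {O : Subring D} {τ : D}

namespace IsCentralPole

theorem ne_zero (h : IsCentralPole O τ) : τ ≠ 0 := by
  rintro rfl
  exact h.notMem O.zero_mem

theorem zpow_mem (h : IsCentralPole O τ) {k : ℤ} (hk : k ≤ 0) : τ ^ k ∈ O := by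
  obtain ⟨m, rfl⟩ := Int.eq_ofNat_of_zero_le (neg_nonneg.2 hk) |>.imp fun m hm =>
    neg_eq_iff_eq_neg.1 hm
  rw [zpow_neg, zpow_natCast, ← inv_pow]
  exact O.pow_mem h.inv_mem m

theorem nonpos_of_zpow_mem (h : IsCentralPole O τ) {k : ℤ} (hk : τ ^ k ∈ O) : k ≤ 0 := by
  by_contra! hlt
  refine h.notMem ?_
  have := O.mul_mem hk (h.zpow_mem (k := 1 - k) (by omega))
  rwa [← zpow_add₀ h.ne_zero, add_sub_cancel, zpow_one] at this

theorem zpow_commute (h : IsCentralPole O τ) (k : ℤ) (x : D) : Commute (τ ^ k) x :=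
  (h.commute x).zpow_left₀ k

theorem inv_pow_commute (h : IsCentralPole O τ) (k : ℕ) (x : D) : Commute (τ⁻¹ ^ k) x :=
  ((h.commute x).inv_left₀).pow_left k

/-- Every element of `D` is moved into `O` by a high power of the uniformizer. -/
theorem exists_inv_pow_mul_mem (h : IsCentralPole O τ) (x : D) : ∃ k : ℕ, τ⁻¹ ^ k * x ∈ O := by
  by_cases hx : x = 0
  · exact ⟨0, by simp [hx, O.zero_mem]⟩
  obtain ⟨k, hk, -⟩ := h.exists_unit x hx
  refine ⟨(-k).toNat, ?_⟩
  have h1 : τ⁻¹ ^ (-k).toNat * x = x * τ ^ k * τ ^ (-k - ((-k).toNat : ℤ)) := by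
    rw [mul_assoc, ← zpow_add₀ h.ne_zero, (h.inv_pow_commute _ x).eq, inv_pow, ← zpow_natCast,
      ← zpow_neg]
    congr 2
    ring
  rw [h1]
  exact O.mul_mem hk (h.zpow_mem (by omega))

theorem inv_pow_mul_mem_of_le (h : IsCentralPole O τ) {x : D} {k l : ℕ} (hkl : k ≤ l)
    (hx : τ⁻¹ ^ k * x ∈ O) : τ⁻¹ ^ l * x ∈ O := by
  obtain ⟨m, rfl⟩ := Nat.exists_eq_add_of_le' hkl
  rw [pow_add, mul_assoc]
  exact O.mul_mem (O.pow_mem h.inv_mem m) hx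

theorem exists_inv_pow_mul_mem_forall (h : IsCentralPole O τ) {ι : Type*} [Finite ι]
    (x : ι → D) : ∃ k : ℕ, ∀ i, τ⁻¹ ^ k * x i ∈ O := by
  cases nonempty_fintype ι
  choose k hk using fun i => h.exists_inv_pow_mul_mem (x i)
  exact ⟨Finset.univ.sup k, fun i =>
    h.inv_pow_mul_mem_of_le (Finset.le_sup (Finset.mem_univ i)) (hk i)⟩

theorem inv_pow_add_mul_mem (h : IsCentralPole O τ) {x y : D} {k l : ℕ}
    (hx : τ⁻¹ ^ k * x ∈ O) (hy : τ⁻¹ ^ l * y ∈ O) : τ⁻¹ ^ (k + l) * (x * y) ∈ O := by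
  have := O.mul_mem hx hy
  rwa [mul_assoc, ← mul_assoc x, ← (h.inv_pow_commute l x).eq, mul_assoc, ← mul_assoc,
    ← pow_add] at this

/-- An element whose inverse is not in `O` is divisible by the uniformizer in `O`. -/
theorem inv_mem_or_mul_mem (h : IsCentralPole O τ) (a : D) :
    (a ≠ 0 ∧ a⁻¹ ∈ O) ∨ τ * a ∈ O := by
  by_cases h0 : a = 0
  · exact Or.inr (by simp [h0, O.zero_mem])
  obtain ⟨k, h1, h2⟩ := h.exists_unit a h0
  rcases le_or_gt k 0 with hk | hk
  · refine Or.inl ⟨h0, ?_⟩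
    have := O.mul_mem (h.zpow_mem hk) h2
    rwa [mul_inv_rev, ← mul_assoc, mul_inv_cancel₀ (zpow_ne_zero _ h.ne_zero), one_mul] at this
  · refine Or.inr ?_
    have := O.mul_mem h1 (h.zpow_mem (k := 1 - k) (by omega))
    rwa [mul_assoc, ← zpow_add₀ h.ne_zero, add_sub_cancel, zpow_one, ← (h.commute a).eq] at this

/-- The opposite of a discrete valuation ring with central uniformizer is again one. -/
theorem op (h : IsCentralPole O τ) : IsCentralPole O.op (MulOpposite.op τ) where
  commute x := by
    have := h.commute x.unop
    exact MulOpposite.unop_injective this.eq.symm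
  inv_mem := by simpa [Subring.mem_op] using h.inv_mem
  notMem := by simpa [Subring.mem_op] using h.notMem
  exists_unit x hx := by
    obtain ⟨k, h1, h2⟩ := h.exists_unit x.unop (by simpa using hx)
    refine ⟨k, ?_, ?_⟩
    · rw [Subring.mem_op, MulOpposite.unop_mul, MulOpposite.unop_zpow, MulOpposite.unop_op,
        (h.zpow_commute k _).eq]
      exact h1
    · rw [Subring.mem_op, MulOpposite.unop_inv, MulOpposite.unop_mul, MulOpposite.unop_zpow,
        MulOpposite.unop_op, (h.zpow_commute k _).eq]
      exact h2

end IsCentralPole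

/-! ### Full bounded submodules -/

variable {V : Type*} [AddCommGroup V] [Module D V] [Module O V] [IsScalarTower O D V] {n : ℕ}

theorem smul_eq_coe_smul (a : O) (v : V) : a • v = (a : D) • v := by
  rw [← one_smul D v, ← smul_assoc, Subring.smul_def, smul_eq_mul, mul_one, one_smul]

theorem smul_mem_of_mem {L : Submodule O V} {a : D} (ha : a ∈ O) {v : V} (hv : v ∈ L) :
    a • v ∈ L := by
  simpa [smul_eq_coe_smul] using L.smul_mem ⟨a, ha⟩ hv

/-- Multiplication by the central element `τ`, as an automorphism of the `O`-module `V`. -/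
noncomputable def scaleEquiv (V : Type*) [AddCommGroup V] [Module D V] [Module O V]
    [IsScalarTower O D V] (h : IsCentralPole O τ) : V ≃ₗ[O] V where
  toFun v := τ • v
  invFun v := τ⁻¹ • v
  map_add' := smul_add τ
  map_smul' a v := by
    rw [smul_eq_coe_smul, smul_eq_coe_smul, smul_smul, RingHom.id_apply, smul_smul,
      (h.commute _).eq]
  left_inv v := inv_smul_smul₀ h.ne_zero v
  right_inv v := smul_inv_smul₀ h.ne_zero v

theorem inv_pow_smul_mem_of_le (h : IsCentralPole O τ) {L : Submodule O V} {v : V} {k l : ℕ}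
    (hkl : k ≤ l) (hv : τ⁻¹ ^ k • v ∈ L) : τ⁻¹ ^ l • v ∈ L := by
  obtain ⟨m, rfl⟩ := Nat.exists_eq_add_of_le' hkl
  rw [pow_add, mul_smul]
  exact smul_mem_of_mem (O.pow_mem h.inv_mem m) hv

/-- `L` is a lattice in the valuation-theoretic sense: every vector is moved into `L` by a power of
the uniformizer `τ⁻¹`, and the coordinates of the elements of `L` have bounded denominators. -/
structure IsFullBounded (O : Subring D) [Module O V] (τ : D) (e : Module.Basis (Fin n) D V)
    (L : Submodule O V) : Prop where
  full : ∀ v : V, ∃ k : ℕ, τ⁻¹ ^ k • v ∈ L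
  bounded : ∃ k : ℕ, ∀ v ∈ L, ∀ i, τ⁻¹ ^ k * e.repr v i ∈ O

variable {e : Module.Basis (Fin n) D V} {L L' N : Submodule O V}

theorem IsFullBounded.of_le_of_le (hL : IsFullBounded O τ e L) (hL' : IsFullBounded O τ e L')
    (h1 : L ≤ N) (h2 : N ≤ L') : IsFullBounded O τ e N :=
  ⟨fun v => (hL.full v).imp fun _ hk => h1 hk,
    hL'.bounded.imp fun _ hk v hv => hk v (h2 hv)⟩

theorem IsFullBounded.inf (h : IsCentralPole O τ) (hL : IsFullBounded O τ e L)
    (hL' : IsFullBounded O τ e L') : IsFullBounded O τ e (L ⊓ L') where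
  full v := by
    obtain ⟨k, hk⟩ := hL.full v
    obtain ⟨l, hl⟩ := hL'.full v
    exact ⟨max k l, inv_pow_smul_mem_of_le h (le_max_left k l) hk,
      inv_pow_smul_mem_of_le h (le_max_right k l) hl⟩
  bounded := hL.bounded.imp fun _ hk v hv => hk v hv.1

theorem IsFullBounded.sup (h : IsCentralPole O τ) (hL : IsFullBounded O τ e L)
    (hL' : IsFullBounded O τ e L') : IsFullBounded O τ e (L ⊔ L') where
  full v := (hL.full v).imp fun _ hk => le_sup_left (a := L) hk
  bounded := by
    obtain ⟨k, hk⟩ := hL.bounded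
    obtain ⟨l, hl⟩ := hL'.bounded
    refine ⟨max k l, fun v hv i => ?_⟩
    obtain ⟨x, hx, y, hy, rfl⟩ := Submodule.mem_sup.1 hv
    rw [map_add, Finsupp.add_apply, mul_add]
    exact O.add_mem (h.inv_pow_mul_mem_of_le (le_max_left k l) (hk x hx i))
      (h.inv_pow_mul_mem_of_le (le_max_right k l) (hl y hy i))

theorem IsFullBounded.map_scale (h : IsCentralPole O τ) (hL : IsFullBounded O τ e L) :
    IsFullBounded O τ e (L.map (scaleEquiv V h : V →ₗ[O] V)) where
  full v := by
    obtain ⟨k, hk⟩ := hL.full (τ⁻¹ • v)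
    refine ⟨k, _, hk, ?_⟩
    change τ • (τ⁻¹ ^ k • τ⁻¹ • v) = _
    rw [smul_smul, smul_smul, mul_assoc, ← pow_succ, pow_succ', mul_inv_cancel_left₀ h.ne_zero]
  bounded := by
    obtain ⟨k, hk⟩ := hL.bounded
    refine ⟨k + 1, ?_⟩
    rintro _ ⟨v, hv, rfl⟩ i
    change τ⁻¹ ^ (k + 1) * e.repr (τ • v) i ∈ O
    rw [map_smul, Finsupp.smul_apply, smul_eq_mul, ← mul_assoc, pow_succ,
      inv_mul_cancel_right₀ h.ne_zero]
    exact hk v hv i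

theorem IsFullBounded.map_scale_symm (h : IsCentralPole O τ) (hL : IsFullBounded O τ e L) :
    IsFullBounded O τ e (L.map ((scaleEquiv V h).symm : V →ₗ[O] V)) where
  full v := by
    obtain ⟨k, hk⟩ := hL.full v
    refine ⟨k + 1, _, hk, ?_⟩
    change τ⁻¹ • (τ⁻¹ ^ k • v) = _
    rw [smul_smul, pow_succ']
  bounded := by
    obtain ⟨k, hk⟩ := hL.bounded
    refine ⟨k, ?_⟩
    rintro _ ⟨v, hv, rfl⟩ i
    change τ⁻¹ ^ k * e.repr (τ⁻¹ • v) i ∈ O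
    rw [map_smul, Finsupp.smul_apply, smul_eq_mul, ← mul_assoc, ← pow_succ, pow_succ', mul_assoc]
    exact O.mul_mem h.inv_mem (hk v hv i)

/-- Any two lattices are commensurable. -/
theorem IsFullBounded.exists_inv_pow_smul_mem (h : IsCentralPole O τ)
    (hL : IsFullBounded O τ e L) (hL' : IsFullBounded O τ e L') :
    ∃ k : ℕ, ∀ v ∈ L, τ⁻¹ ^ k • v ∈ L' := by
  obtain ⟨k, hk⟩ := hL.bounded
  choose l hl using fun i => hL'.full (e i)
  refine ⟨Finset.univ.sup l + k, fun v hv => ?_⟩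
  rw [← e.sum_repr v, Finset.smul_sum]
  refine Submodule.sum_mem _ fun i _ => ?_
  rw [smul_smul, pow_add, mul_assoc, (h.inv_pow_commute _ _).eq, mul_smul]
  exact smul_mem_of_mem (hk v hv i)
    (inv_pow_smul_mem_of_le h (Finset.le_sup (Finset.mem_univ i)) (hl i))

/-- Full-rank free submodules are full and bounded: a basis over `O` is linearly independent over
`D` after clearing denominators, hence spans `V`. -/
theorem isFullBounded_of_basis (h : IsCentralPole O τ) (e : Module.Basis (Fin n) D V)
    (b : Module.Basis (Fin n) O L) : IsFullBounded O τ e L := by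
  have hli : LinearIndependent D (fun i => (b i : V)) := by
    rw [Fintype.linearIndependent_iff]
    intro c hc i
    obtain ⟨k, hk⟩ := h.exists_inv_pow_mul_mem_forall c
    have h0 : ∑ j, (⟨τ⁻¹ ^ k * c j, hk j⟩ : O) • b j = 0 := by
      apply Subtype.ext
      rw [Submodule.coe_sum, Submodule.coe_zero, ← smul_zero (τ⁻¹ ^ k), ← hc, Finset.smul_sum]
      refine Finset.sum_congr rfl fun j _ => ?_
      rw [Submodule.coe_smul, smul_eq_coe_smul, smul_smul]
    have := Fintype.linearIndependent_iff.1 b.linearIndependent _ h0 i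
    have h1 : τ⁻¹ ^ k * c i = 0 := congrArg Subtype.val this
    exact (mul_eq_zero.1 h1).resolve_left (pow_ne_zero _ (inv_ne_zero h.ne_zero))
  have : Module.Finite D V := Module.Finite.of_basis e
  have hspan := hli.span_eq_top_of_card_eq_finrank' (by
    rw [Module.finrank_eq_card_basis e])
  constructor
  · intro v
    have hv : v ∈ Submodule.span D (Set.range fun i => (b i : V)) := hspan ▸ Submodule.mem_top
    obtain ⟨c, rfl⟩ := (Submodule.mem_span_range_iff_exists_fun D).1 hv
    obtain ⟨k, hk⟩ := h.exists_inv_pow_mul_mem_forall c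
    refine ⟨k, ?_⟩
    rw [Finset.smul_sum]
    refine Submodule.sum_mem _ fun i _ => ?_
    rw [smul_smul]
    exact smul_mem_of_mem (hk i) (b i).2
  · obtain ⟨k, hk⟩ := h.exists_inv_pow_mul_mem_forall
      fun p : Fin n × Fin n => e.repr (b p.1 : V) p.2
    refine ⟨k, fun v hv i => ?_⟩
    have hs : v = ∑ j, ((b.repr ⟨v, hv⟩ j : O) : D) • (b j : V) := by
      have := congrArg (Subtype.val : L → V) (b.sum_repr ⟨v, hv⟩)
      rw [Submodule.coe_sum] at this
      refine this.symm.trans ?_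
      exact Finset.sum_congr rfl fun j _ => by rw [Submodule.coe_smul, smul_eq_coe_smul]
    rw [hs, map_sum, Finsupp.finsetSum_apply, Finset.mul_sum]
    refine O.sum_mem fun j _ => ?_
    rw [map_smul, Finsupp.smul_apply, smul_eq_mul, ← mul_assoc, (h.inv_pow_commute _ _).eq,
      mul_assoc]
    exact O.mul_mem (Subtype.mem _) (hk (j, i))

/-! ### Echelon bases and the height -/

/-- The exponents `k` such that `L` has an element whose first coordinate that may be nonzero is
the `i`-th one, with value `τ ^ k`. -/
def pivotSet (τ : D) (e : Module.Basis (Fin n) D V) (L : Submodule O V) (i : Fin n) : Set ℤ :=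
  {k | ∃ v ∈ L, (∀ j < i, e.repr v j = 0) ∧ e.repr v i = τ ^ k}

/-- The largest exponent in `pivotSet`. -/
noncomputable def pivot (τ : D) (e : Module.Basis (Fin n) D V) (L : Submodule O V)
    (i : Fin n) : ℤ :=
  sSup (pivotSet τ e L i)

theorem pivotSet_nonempty (hL : IsFullBounded O τ e L) (i : Fin n) :
    (pivotSet τ e L i).Nonempty := by
  obtain ⟨k, hk⟩ := hL.full (e i)
  refine ⟨-(k : ℤ), _, hk, fun j hj => ?_, ?_⟩
  · rw [map_smul, e.repr_self, Finsupp.smul_apply, Finsupp.single_eq_of_ne hj.ne, smul_zero]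
  · rw [map_smul, e.repr_self, Finsupp.smul_apply, Finsupp.single_eq_same, smul_eq_mul, mul_one,
      inv_pow, zpow_neg, zpow_natCast]

theorem pivotSet_bddAbove (h : IsCentralPole O τ) (hL : IsFullBounded O τ e L) (i : Fin n) :
    BddAbove (pivotSet τ e L i) := by
  obtain ⟨k, hk⟩ := hL.bounded
  refine ⟨k, ?_⟩
  rintro m ⟨v, hv, -, hm⟩
  have := hk v hv i
  rw [hm, inv_pow, ← zpow_natCast, ← zpow_neg, ← zpow_add₀ h.ne_zero] at this
  have := h.nonpos_of_zpow_mem this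
  omega

theorem pivot_mem (h : IsCentralPole O τ) (hL : IsFullBounded O τ e L) (i : Fin n) :
    pivot τ e L i ∈ pivotSet τ e L i :=
  Int.csSup_mem (pivotSet_nonempty hL i) (pivotSet_bddAbove h hL i)

theorem pivot_mono (h : IsCentralPole O τ) (hL : IsFullBounded O τ e L)
    (hL' : IsFullBounded O τ e L') (hle : L ≤ L') (i : Fin n) :
    pivot τ e L i ≤ pivot τ e L' i :=
  csSup_le_csSup (pivotSet_bddAbove h hL' i) (pivotSet_nonempty hL i)
    fun _ ⟨v, hv, hk⟩ => ⟨v, hle hv, hk⟩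

theorem mul_zpow_neg_pivot_mem (h : IsCentralPole O τ) (hL : IsFullBounded O τ e L) {i : Fin n}
    {v : V} (hv : v ∈ L) (hz : ∀ j < i, e.repr v j = 0) :
    e.repr v i * τ ^ (-pivot τ e L i) ∈ O := by
  by_cases h0 : e.repr v i = 0
  · rw [h0, zero_mul]
    exact O.zero_mem
  obtain ⟨k, h1, h2⟩ := h.exists_unit _ h0
  have hk : -k ∈ pivotSet τ e L i := by
    refine ⟨_, smul_mem_of_mem h2 hv, fun j hj => ?_, ?_⟩
    · rw [map_smul, Finsupp.smul_apply, hz j hj, smul_zero]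
    · rw [map_smul, Finsupp.smul_apply, smul_eq_mul, mul_inv_rev, mul_assoc, inv_mul_cancel₀ h0,
        mul_one, zpow_neg]
  have hle : -k ≤ pivot τ e L i := le_csSup (pivotSet_bddAbove h hL i) hk
  have := O.mul_mem h1 (h.zpow_mem (k := -k - pivot τ e L i) (by omega))
  rwa [mul_assoc, ← zpow_add₀ h.ne_zero, sub_eq_add_neg, add_neg_cancel_left] at this

/-- Gaussian elimination: vectors in echelon form whose leading coefficients realize the pivots of
`L` generate a submodule containing `L`. -/
theorem le_span_of_pivot (h : IsCentralPole O τ) (hL : IsFullBounded O τ e L) {b : Fin n → V}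
    (hb : ∀ i, b i ∈ L) (hz : ∀ i, ∀ j < i, e.repr (b i) j = 0)
    (hp : ∀ i, e.repr (b i) i = τ ^ pivot τ e L i) : L ≤ Submodule.span O (Set.range b) := by
  have key : ∀ d : ℕ, ∀ v ∈ L, (∀ j : Fin n, (j : ℕ) + d < n → e.repr v j = 0) →
      v ∈ Submodule.span O (Set.range b) := by
    intro d
    induction d with
    | zero =>
      intro v _ hv
      have : v = 0 := e.repr.map_eq_zero_iff.1 (Finsupp.ext fun j => hv j (by simp))
      rw [this]
      exact Submodule.zero_mem _
    | succ d ih =>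
      intro v hv hvz
      by_cases hd : d + 1 ≤ n
      · set i : Fin n := ⟨n - d - 1, by omega⟩ with hi
        have hvi : ∀ j < i, e.repr v j = 0 := fun j hj => hvz j (by
          have : (j : ℕ) < n - d - 1 := hj
          omega)
        set c := e.repr v i * τ ^ (-pivot τ e L i) with hc
        have hcO : c ∈ O := mul_zpow_neg_pivot_mem h hL hv hvi
        have hs : v - c • b i ∈ Submodule.span O (Set.range b) := by
          refine ih _ (L.sub_mem hv (smul_mem_of_mem hcO (hb i))) fun j hj => ?_
          rw [map_sub, map_smul, Finsupp.sub_apply, Finsupp.smul_apply, smul_eq_mul]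
          have hji : j ≤ i := by
            change (j : ℕ) ≤ n - d - 1
            omega
          rcases hji.lt_or_eq with hlt | rfl
          · rw [hvi j hlt, hz i j hlt, mul_zero, sub_zero]
          · rw [hp, hc, mul_assoc, ← zpow_add₀ h.ne_zero, neg_add_cancel, zpow_zero, mul_one,
              sub_self]
        have := Submodule.add_mem _ hs
          (smul_mem_of_mem hcO (Submodule.subset_span (Set.mem_range_self i)))
        rwa [sub_add_cancel] at this
      · exact ih v hv fun j hj => by omega
  exact fun v hv => key n v hv fun j hj => by omega

theorem exists_echelon (h : IsCentralPole O τ) (hL : IsFullBounded O τ e L) :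
    ∃ b : Fin n → V, (∀ i, b i ∈ L) ∧ (∀ i, ∀ j < i, e.repr (b i) j = 0) ∧
      ∀ i, e.repr (b i) i = τ ^ pivot τ e L i := by
  choose b hb hz hp using pivot_mem h hL
  exact ⟨b, hb, hz, hp⟩

/-- Full bounded submodules are free of full rank, with an echelon basis. -/
theorem nonempty_basis_of_isFullBounded (h : IsCentralPole O τ) (hL : IsFullBounded O τ e L) :
    Nonempty (Module.Basis (Fin n) O L) := by
  obtain ⟨b, hb, hz, hp⟩ := exists_echelon h hL
  have hspan := le_span_of_pivot h hL hb hz hp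
  have hD : ⊤ ≤ Submodule.span D (Set.range b) := by
    intro v _
    obtain ⟨k, hk⟩ := hL.full v
    obtain ⟨c, hc⟩ := (Submodule.mem_span_range_iff_exists_fun O).1 (hspan hk)
    have h1 : τ⁻¹ ^ k • v ∈ Submodule.span D (Set.range b) := by
      rw [← hc]
      refine Submodule.sum_mem _ fun i _ => ?_
      rw [smul_eq_coe_smul]
      exact Submodule.smul_mem _ _ (Submodule.subset_span (Set.mem_range_self i))
    exact (Submodule.smul_mem_iff _ (pow_ne_zero k (inv_ne_zero h.ne_zero))).1 h1
  have hli : LinearIndependent D b := linearIndependent_of_top_le_span_of_card_eq_finrank hD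
    (by rw [Module.finrank_eq_card_basis e])
  have hliO : LinearIndependent O b := hli.restrict_scalars fun x y hxy => by
    simpa [Subring.smul_def] using hxy
  have heq : Submodule.span O (Set.range b) = L :=
    le_antisymm (Submodule.span_le.2 (Set.range_subset_iff.2 hb)) hspan
  exact ⟨(Module.Basis.span hliO).map (LinearEquiv.ofEq _ _ heq)⟩

theorem nonempty_basis_iff (h : IsCentralPole O τ) (e : Module.Basis (Fin n) D V) :
    Nonempty (Module.Basis (Fin n) O L) ↔ IsFullBounded O τ e L :=
  ⟨fun ⟨b⟩ => isFullBounded_of_basis h e b, nonempty_basis_of_isFullBounded h⟩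

theorem eq_of_le_of_pivot_eq (h : IsCentralPole O τ) (hL : IsFullBounded O τ e L)
    (hL' : IsFullBounded O τ e L') (hle : L ≤ L')
    (hp : ∀ i, pivot τ e L i = pivot τ e L' i) : L = L' := by
  obtain ⟨b, hb, hz, hpiv⟩ := exists_echelon h hL
  refine le_antisymm hle ((le_span_of_pivot h hL' (fun i => hle (hb i)) hz
    fun i => by rw [hpiv, hp]).trans (Submodule.span_le.2 (Set.range_subset_iff.2 hb)))

/-- The sum of the pivots is a strictly monotone integer-valued function on lattices; it replaces
the length function in proving that chains in intervals are finite. -/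
theorem sum_pivot_lt (h : IsCentralPole O τ) (hL : IsFullBounded O τ e L)
    (hL' : IsFullBounded O τ e L') (hlt : L < L') :
    ∑ i, pivot τ e L i < ∑ i, pivot τ e L' i := by
  have hmono := fun i (_ : i ∈ Finset.univ) => pivot_mono h hL hL' hlt.le i
  refine lt_of_le_of_ne (Finset.sum_le_sum hmono) fun heq => hlt.ne ?_
  exact eq_of_le_of_pivot_eq h hL hL' hlt.le fun i =>
    (Finset.sum_eq_sum_iff_of_le hmono).1 heq i (Finset.mem_univ i)

/-! ### The lattice of full-rank free submodules -/

/-- The full-rank free `O`-submodules of `V`, ordered by inclusion. -/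
abbrev FreeLat (O : Subring D) (V : Type*) [AddCommGroup V] [Module O V] (n : ℕ) : Type _ :=
  {L : Submodule O V // Nonempty (Module.Basis (Fin n) O L)}

theorem isFullBounded (h : IsCentralPole O τ) (e : Module.Basis (Fin n) D V) (L : FreeLat O V n) :
    IsFullBounded O τ e L.1 :=
  (nonempty_basis_iff h e).1 L.2

/-- Sums and intersections of full-rank free submodules are free of full rank. -/
abbrev latticeFreeLat (h : IsCentralPole O τ) (e : Module.Basis (Fin n) D V) :
    Lattice (FreeLat O V n) :=
  Subtype.lattice
    (fun _ _ hL hL' => (nonempty_basis_iff h e).2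
      (((nonempty_basis_iff h e).1 hL).sup h ((nonempty_basis_iff h e).1 hL')))
    (fun _ _ hL hL' => (nonempty_basis_iff h e).2
      (((nonempty_basis_iff h e).1 hL).inf h ((nonempty_basis_iff h e).1 hL')))

theorem isModularLattice_freeLat (h : IsCentralPole O τ) (e : Module.Basis (Fin n) D V) :
    @IsModularLattice (FreeLat O V n) (latticeFreeLat h e) :=
  letI := latticeFreeLat h e
  ⟨fun {x} y {z} hxz => IsModularLattice.sup_inf_le_assoc_of_le (x := x.1) y.1 (z := z.1) hxz⟩

/-- The automorphism `L ↦ τ L` of the lattice of full-rank free submodules. -/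
noncomputable def scaleIso (h : IsCentralPole O τ) (e : Module.Basis (Fin n) D V) :
    FreeLat O V n ≃o FreeLat O V n where
  toFun L := ⟨L.1.map (scaleEquiv V h : V →ₗ[O] V),
    (nonempty_basis_iff h e).2 ((isFullBounded h e L).map_scale h)⟩
  invFun L := ⟨L.1.map ((scaleEquiv V h).symm : V →ₗ[O] V),
    (nonempty_basis_iff h e).2 ((isFullBounded h e L).map_scale_symm h)⟩
  left_inv L := Subtype.ext <| SetLike.coe_injective <| by
    simp [Set.image_image]
  right_inv L := Subtype.ext <| SetLike.coe_injective <| by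
    simp [Set.image_image]
  map_rel_iff' := Submodule.map_le_map_iff_of_injective (scaleEquiv V h).injective _ _

theorem coe_scaleIso_symm (h : IsCentralPole O τ) (e : Module.Basis (Fin n) D V)
    (L : FreeLat O V n) :
    (((scaleIso h e).symm L).1 : Set V) = (fun v => τ⁻¹ • v) '' (L.1 : Set V) := rfl

theorem mem_scaleIso (h : IsCentralPole O τ) (e : Module.Basis (Fin n) D V) {L : FreeLat O V n}
    {v : V} : v ∈ (scaleIso h e L).1 ↔ τ⁻¹ • v ∈ L.1 :=
  ⟨by rintro ⟨w, hw, rfl⟩; exact (inv_smul_smul₀ h.ne_zero w).symm ▸ hw,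
    fun hv => ⟨_, hv, smul_inv_smul₀ h.ne_zero v⟩⟩

theorem le_scaleIso (h : IsCentralPole O τ) (e : Module.Basis (Fin n) D V) (L : FreeLat O V n) :
    L ≤ scaleIso h e L :=
  fun _ hv => (mem_scaleIso h e).2 (smul_mem_of_mem h.inv_mem hv)

theorem scaleIso_symm_le (h : IsCentralPole O τ) (e : Module.Basis (Fin n) D V)
    (L : FreeLat O V n) : (scaleIso h e).symm L ≤ L :=
  (OrderIso.symm_apply_le _).2 (le_scaleIso h e L)

/-- If `τ L ⊆ L`, then `L` is contained in every other lattice. (This happens only if `V = 0`.) -/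
theorem le_of_scaleIso_le (h : IsCentralPole O τ) (e : Module.Basis (Fin n) D V)
    {L U : FreeLat O V n} (hL : scaleIso h e L ≤ L) : L ≤ U := by
  obtain ⟨k, hk⟩ := (isFullBounded h e L).exists_inv_pow_smul_mem h (isFullBounded h e U)
  have hpow : ∀ k : ℕ, ∀ v ∈ L.1, τ ^ k • v ∈ L.1 := by
    intro k
    induction k with
    | zero => intro v hv; simpa using hv
    | succ k ih =>
      intro v hv
      rw [pow_succ', mul_smul]
      exact hL ⟨_, ih v hv, rfl⟩
  intro v hv
  have := hk _ (hpow k v hv)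
  rwa [smul_smul, inv_pow, inv_mul_cancel₀ (pow_ne_zero k h.ne_zero), one_smul] at this

/-- Nakayama's lemma for lattices: if `L ⊆ N` and `N ⊆ L + τ⁻¹ N`, then `N ⊆ L`. -/
theorem le_of_le_sup_inv_smul (h : IsCentralPole O τ) (e : Module.Basis (Fin n) D V)
    {L N : FreeLat O V n} (hN : N.1 ≤ L.1 ⊔ ((scaleIso h e).symm N).1) : N ≤ L := by
  obtain ⟨k, hk⟩ := (isFullBounded h e N).exists_inv_pow_smul_mem h (isFullBounded h e L)
  have key : ∀ k : ℕ, ∀ v ∈ N.1, ∃ w ∈ N.1, v - τ⁻¹ ^ k • w ∈ L.1 := by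
    intro k
    induction k with
    | zero => exact fun v hv => ⟨v, hv, by simp⟩
    | succ k ih =>
      intro v hv
      obtain ⟨w, hw, hvw⟩ := ih v hv
      obtain ⟨x, hx, y, ⟨z, hz, hzy⟩, hxy⟩ := Submodule.mem_sup.1 (hN hw)
      refine ⟨z, hz, ?_⟩
      have hzy' : τ⁻¹ • z = y := hzy
      have : v - τ⁻¹ ^ (k + 1) • z = (v - τ⁻¹ ^ k • w) + τ⁻¹ ^ k • x := by
        rw [← hxy, ← hzy', pow_succ, mul_smul, smul_add]
        abel
      rw [this]
      exact L.1.add_mem hvw (smul_mem_of_mem (O.pow_mem h.inv_mem k) hx)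
  intro v hv
  obtain ⟨w, hw, hvw⟩ := key k v hv
  simpa using L.1.add_mem hvw (hk w hw)

/-- A lattice covering `L` is contained in `τ L`. -/
theorem le_scaleIso_of_covBy (h : IsCentralPole O τ) (e : Module.Basis (Fin n) D V)
    {L N : FreeLat O V n} (hLN : L ⋖ N) : N ≤ scaleIso h e L := by
  let := latticeFreeLat h e
  rw [← OrderIso.symm_apply_le]
  have hle : L ⊔ (scaleIso h e).symm N ≤ N := sup_le hLN.le (scaleIso_symm_le h e N)
  rcases hLN.eq_or_eq le_sup_left hle with heq | heq
  · exact le_sup_right.trans heq.le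
  · exact absurd (le_of_le_sup_inv_smul h e heq.ge) hLN.lt.not_ge

/-- If `N = L + O u` with `u ∉ L` and `τ⁻¹ u ∈ L`, then `N` covers `L`: the quotient is a
one-dimensional space over the residue field. -/
theorem covBy_of_eq_sup_span (h : IsCentralPole O τ) {L N : FreeLat O V n} {u : V}
    (hu : u ∉ L.1) (hτu : τ⁻¹ • u ∈ L.1) (hN : N.1 = L.1 ⊔ Submodule.span O {u}) : L ⋖ N := by
  have huN : u ∈ N.1 := hN ▸ le_sup_right (a := L.1) (Submodule.mem_span_singleton_self u)
  have hLN : L ≤ N := fun v hv => hN ▸ le_sup_left (a := L.1) hv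
  refine ⟨lt_of_le_not_ge hLN fun hle => hu (hle huN), ?_⟩
  intro K hLK hKN
  obtain ⟨v, hvK, hvL⟩ := SetLike.not_le_iff_exists.1 (show ¬ K.1 ≤ L.1 from hLK.not_ge)
  have hvN : v ∈ N.1 := hKN.le hvK
  rw [hN] at hvN
  obtain ⟨x, hx, y, hy, rfl⟩ := Submodule.mem_sup.1 hvN
  obtain ⟨a, rfl⟩ := Submodule.mem_span_singleton.1 hy
  rw [smul_eq_coe_smul] at hvK hvL
  rcases h.inv_mem_or_mul_mem (a : D) with ⟨ha0, ha⟩ | ha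
  · have hau : (a : D) • u ∈ K.1 := by
      simpa using K.1.sub_mem hvK (hLK.le hx)
    have huK : u ∈ K.1 := by
      simpa [inv_smul_smul₀ ha0] using smul_mem_of_mem ha hau
    refine hKN.not_ge ?_
    change N.1 ≤ K.1
    rw [hN]
    exact sup_le hLK.le ((Submodule.span_singleton_le_iff_mem _ _).2 huK)
  · refine hvL (L.1.add_mem hx ?_)
    have := smul_mem_of_mem ha hτu
    rwa [smul_smul, (h.commute _).eq, mul_assoc, mul_inv_cancel₀ h.ne_zero, mul_one] at this

/-- Every element of `τ L` outside `L` lies in a lattice covering `L`. -/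
theorem exists_covBy_mem (h : IsCentralPole O τ) (e : Module.Basis (Fin n) D V)
    {L : FreeLat O V n} {u : V} (hu : u ∈ (scaleIso h e L).1) (huL : u ∉ L.1) :
    ∃ N, L ⋖ N ∧ u ∈ N.1 := by
  have hN : IsFullBounded O τ e (L.1 ⊔ Submodule.span O {u}) :=
    (isFullBounded h e L).of_le_of_le (isFullBounded h e (scaleIso h e L)) le_sup_left
      (sup_le (le_scaleIso h e L) ((Submodule.span_singleton_le_iff_mem _ _).2 hu))
  exact ⟨⟨_, (nonempty_basis_iff h e).2 hN⟩,
    covBy_of_eq_sup_span h huL ((mem_scaleIso h e).1 hu) rfl,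
    le_sup_right (a := L.1) (Submodule.mem_span_singleton_self u)⟩

/-- The join of the lattices covering `L` is `τ L`. -/
theorem isLUB_covBy (h : IsCentralPole O τ) (e : Module.Basis (Fin n) D V) (L : FreeLat O V n) :
    IsLUB {N | L ⋖ N} (scaleIso h e L) := by
  refine ⟨fun N hN => le_scaleIso_of_covBy h e hN, fun U hU => ?_⟩
  have hLU : L ≤ U := by
    by_cases hL : scaleIso h e L ≤ L
    · exact le_of_scaleIso_le h e hL
    · obtain ⟨u, hu, huL⟩ := SetLike.not_le_iff_exists.1
        (show ¬ (scaleIso h e L).1 ≤ L.1 from hL)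
      obtain ⟨N, hLN, -⟩ := exists_covBy_mem h e hu huL
      exact hLN.le.trans (hU hLN)
  intro u hu
  by_cases huL : u ∈ L.1
  · exact hLU huL
  · obtain ⟨N, hLN, huN⟩ := exists_covBy_mem h e hu huL
    exact hU hLN huN

/-- Every element of `L` outside `τ⁻¹ L` is avoided by some lattice covered by `L`. -/
theorem exists_covBy_notMem (h : IsCentralPole O τ) (e : Module.Basis (Fin n) D V)
    {L : FreeLat O V n} {u : V} (hu : u ∈ L.1) (hτu : u ∉ ((scaleIso h e).symm L).1) :
    ∃ N, N ⋖ L ∧ u ∉ N.1 := by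
  set S : Set (Submodule O V) :=
    {N | ((scaleIso h e).symm L).1 ≤ N ∧ N ≤ L.1 ∧ u ∉ N} with hS
  obtain ⟨N, -, hNmax⟩ := zorn_le_nonempty₀ S (fun c hcS hc N hN => by
    refine ⟨sSup c, ⟨(hcS hN).1.trans (le_sSup hN), sSup_le fun K hK => (hcS hK).2.1, ?_⟩,
      fun K hK => le_sSup hK⟩
    rw [Submodule.mem_sSup_of_directed ⟨N, hN⟩ hc.directedOn]
    rintro ⟨K, hK, huK⟩
    exact (hcS hK).2.2 huK) _ ⟨le_rfl, scaleIso_symm_le h e L, hτu⟩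
  obtain ⟨hN1, hN2, hN3⟩ := hNmax.prop
  have hmem : ∀ v ∈ L.1, τ⁻¹ • v ∈ N := fun v hv => hN1 ⟨v, hv, rfl⟩
  -- By maximality, `u` lies in `N + O v` for each `v ∈ L \ N`; the coefficient of `v` is a unit.
  have hsup : L.1 ≤ N ⊔ Submodule.span O {u} := by
    intro v hv
    by_cases hvN : v ∈ N
    · exact le_sup_left (a := N) hvN
    have huv : u ∈ N ⊔ Submodule.span O {v} := by
      by_contra hcon
      refine hvN (hNmax.le_of_ge ⟨hN1.trans le_sup_left, sup_le hN2
        ((Submodule.span_singleton_le_iff_mem _ _).2 hv), hcon⟩ le_sup_left ?_)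
      exact le_sup_right (a := N) (Submodule.mem_span_singleton_self v)
    obtain ⟨x, hx, y, hy, hxy⟩ := Submodule.mem_sup.1 huv
    obtain ⟨a, rfl⟩ := Submodule.mem_span_singleton.1 hy
    rw [smul_eq_coe_smul] at hxy
    rcases h.inv_mem_or_mul_mem (a : D) with ⟨ha0, ha⟩ | ha
    · have hv' : v = (a : D)⁻¹ • u - (a : D)⁻¹ • x := by
        rw [← smul_sub, ← hxy, add_sub_cancel_left, inv_smul_smul₀ ha0]
      rw [hv']
      exact Submodule.sub_mem _
        (smul_mem_of_mem ha (le_sup_right (a := N) (Submodule.mem_span_singleton_self u)))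
        (smul_mem_of_mem ha (le_sup_left (a := N) hx))
    · refine absurd ?_ hN3
      have := smul_mem_of_mem ha (hmem v hv)
      rw [smul_smul, (h.commute _).eq, mul_assoc, mul_inv_cancel₀ h.ne_zero, mul_one] at this
      exact hxy ▸ N.add_mem hx this
  have hNlat : IsFullBounded O τ e N :=
    (isFullBounded h e ((scaleIso h e).symm L)).of_le_of_le (isFullBounded h e L) hN1 hN2
  refine ⟨⟨N, (nonempty_basis_iff h e).2 hNlat⟩, covBy_of_eq_sup_span h hN3 (hmem u hu) ?_, hN3⟩
  exact le_antisymm hsup (sup_le hN2 ((Submodule.span_singleton_le_iff_mem _ _).2 hu))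

/-- The meet of the lattices covered by `L` is `τ⁻¹ L`. -/
theorem isGLB_covBy (h : IsCentralPole O τ) (e : Module.Basis (Fin n) D V) (L : FreeLat O V n) :
    IsGLB {N | N ⋖ L} ((scaleIso h e).symm L) := by
  refine ⟨fun N hN => (OrderIso.symm_apply_le _).2 (le_scaleIso_of_covBy h e hN), fun U hU => ?_⟩
  have hUL : U ≤ L := by
    by_cases hL : L ≤ (scaleIso h e).symm L
    · rw [OrderIso.le_symm_apply] at hL
      -- Here `τ L = L`, and multiplication by powers of `τ` carries `L` to a lattice above `U`.
      obtain ⟨k, hk⟩ := (isFullBounded h e U).exists_inv_pow_smul_mem h (isFullBounded h e L)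
      intro v hv
      have hpow : ∀ k : ℕ, ∀ w, τ⁻¹ ^ k • w ∈ L.1 → w ∈ L.1 := by
        intro k
        induction k with
        | zero => intro w hw; simpa using hw
        | succ k ih =>
          intro w hw
          rw [pow_succ', mul_smul] at hw
          exact ih w (hL ((mem_scaleIso h e).2 hw))
      exact hpow k v (hk v hv)
    · obtain ⟨u, hu, huL⟩ := SetLike.not_le_iff_exists.1
        (show ¬ L.1 ≤ ((scaleIso h e).symm L).1 from hL)
      obtain ⟨N, hLN, -⟩ := exists_covBy_notMem h e hu huL
      exact (hU hLN).trans hLN.le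
  intro u hu
  by_contra hτu
  obtain ⟨N, hNL, huN⟩ := exists_covBy_notMem h e (hUL hu) hτu
  exact huN (hU hNL hu)

/-- Some lattice has all coordinates of its elements divisible by a prescribed power of the
uniformizer. -/
theorem exists_freeLat (h : IsCentralPole O τ) (e : Module.Basis (Fin n) D V) (k : ℕ) :
    ∃ L : FreeLat O V n, ∀ v ∈ L.1, ∀ i, e.repr v i * τ ^ k ∈ O := by
  let L : Submodule O V :=
    { carrier := {v | ∀ i, e.repr v i * τ ^ k ∈ O}
      zero_mem' := fun i => by simp [O.zero_mem]
      add_mem' := fun {x y} hx hy i => by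
        rw [map_add, Finsupp.add_apply, add_mul]
        exact O.add_mem (hx i) (hy i)
      smul_mem' := fun a x hx i => by
        rw [smul_eq_coe_smul, map_smul, Finsupp.smul_apply, smul_eq_mul, mul_assoc]
        exact O.mul_mem a.2 (hx i) }
  refine ⟨⟨L, (nonempty_basis_iff h e).2 ⟨fun v => ?_, 0, fun v hv i => ?_⟩⟩, fun v hv => hv⟩
  · obtain ⟨l, hl⟩ := h.exists_inv_pow_mul_mem_forall fun i => e.repr v i * τ ^ k
    refine ⟨l, fun i => ?_⟩
    rw [map_smul, Finsupp.smul_apply, smul_eq_mul, mul_assoc]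
    exact hl i
  · have := O.mul_mem (hv i) (O.pow_mem h.inv_mem k)
    rwa [inv_pow, mul_inv_cancel_right₀ (pow_ne_zero k h.ne_zero), ← one_mul (e.repr v i),
      ← pow_zero τ⁻¹] at this

theorem strictMono_sum_pivot (h : IsCentralPole O τ) (e : Module.Basis (Fin n) D V) :
    StrictMono fun L : FreeLat O V n => ∑ i, pivot τ e L.1 i :=
  fun L L' hlt => sum_pivot_lt h (isFullBounded h e L) (isFullBounded h e L') hlt

end CentralPole

namespace SkewRat

/-! ### Products and order duals of uniform modular lattices -/

theorem isAscent_prod {P Q : Type*} [PartialOrder P] [PartialOrder Q] {x x' : P} {y y' : Q}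
    (hx : IsAscent x x') (hy : IsAscent y y') (hxx : x ≤ x') (hyy : y ≤ y') :
    IsAscent (x, y) (x', y') := by
  refine ⟨?_, fun u hu => ⟨hx.2 fun z hz => ?_, hy.2 fun z hz => ?_⟩⟩
  · rintro z hz
    rcases Prod.covBy_iff.1 hz with ⟨h1, h2⟩ | ⟨h1, h2⟩
    · exact ⟨hx.1 h1, h2 ▸ hyy⟩
    · exact ⟨h2 ▸ hxx, hy.1 h1⟩
  · exact (hu (Prod.mk_covBy_mk_iff.2 (Or.inl ⟨hz, rfl⟩)) : (z, y) ≤ u).1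
  · exact (hu (Prod.mk_covBy_mk_iff.2 (Or.inr ⟨hz, rfl⟩)) : (x, z) ≤ u).2

theorem isAscent_toDual {P : Type*} [PartialOrder P] {x x' : P} (hx : IsGLB {z | z ⋖ x} x') :
    IsAscent (OrderDual.toDual x) (OrderDual.toDual x') :=
  ⟨fun _ hz => hx.1 (ofDual_covBy_ofDual_iff.2 hz), fun _ hu =>
    (hx.2 fun _ hz => hu (toDual_covBy_toDual_iff.2 hz) : _ ≤ x')⟩

/-- A strictly monotone function to `ℤ` bounds the length of the chains in an interval. -/
theorem chain_finite_of_strictMono {P : Type*} [PartialOrder P] {f : P → ℤ} (hf : StrictMono f)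
    {x y : P} {C : Set P} (hC : C ⊆ Set.Icc x y) (hchain : IsChain (· ≤ ·) C) : C.Finite := by
  refine Set.Finite.of_finite_image (f := f) ((Set.finite_Icc (f x) (f y)).subset ?_) ?_
  · rintro _ ⟨z, hz, rfl⟩
    exact ⟨hf.monotone (hC hz).1, hf.monotone (hC hz).2⟩
  · intro a ha b hb hab
    by_contra hne
    rcases hchain ha hb hne with hle | hle
    · exact (hf (lt_of_le_of_ne hle hne)).ne hab
    · exact (hf (lt_of_le_of_ne hle (Ne.symm hne))).ne hab.symm

theorem isUniformModularLattice_prod_dual {P Q : Type*} [Lattice P] [IsModularLattice P]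
    [Lattice Q] [IsModularLattice Q] {f : P → ℤ} {g : Q → ℤ} (hf : StrictMono f)
    (hg : StrictMono g) (e : P × Qᵒᵈ ≃o P × Qᵒᵈ) (he : ∀ x, IsAscent x (e x)) :
    IsUniformModularLattice (P × Qᵒᵈ) where
  exists_join x y := ⟨x ⊔ y, isLUB_pair⟩
  exists_meet x y := ⟨x ⊓ y, isGLB_pair⟩
  modular x y z yz xy a b hxz h1 h2 h3 h4 := by
    obtain rfl := h1.unique isGLB_pair
    obtain rfl := h3.unique isLUB_pair
    obtain rfl := h2.unique isLUB_pair
    obtain rfl := h4.unique isGLB_pair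
    exact Prod.ext (sup_inf_assoc_of_le y.1 hxz.1).symm (sup_inf_assoc_of_le y.2 hxz.2).symm
  chain_finite x y C hC hchain := by
    refine chain_finite_of_strictMono
      (f := fun p : P × Qᵒᵈ => f p.1 - g (OrderDual.ofDual p.2)) ?_ hC hchain
    intro p q hpq
    rcases Prod.lt_iff.1 hpq with ⟨h1, h2⟩ | ⟨h1, h2⟩
    · have := hf h1
      have := hg.monotone (OrderDual.ofDual_le_ofDual.2 h2)
      dsimp only
      omega
    · have := hf.monotone h1
      have := hg (OrderDual.ofDual_lt_ofDual.2 h2)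
      dsimp only
      omega
  ascent := ⟨e, he⟩

open RatFun CentralPole

variable {F : Type*} [DivisionRing F] {n : ℕ}

namespace RatFun

/-! ### The degree valuation on `F(t)` -/

theorem ofPoly_mul_oreDiv (p : F[X]) (q : nonZeroDivisors F[X]) :
    ofPoly (q : F[X]) * (show RatFun F from OreLocalization.oreDiv p q) = ofPoly p :=
  OreLocalization.mul_cancel (r := p) (s := q) (t := 1)

theorem deg_t : deg (t F) = 1 := by
  rw [t, deg_ofPoly X X_ne_zero, natDegree_X]
  rfl

theorem t_ne_zero : t F ≠ 0 := by
  intro h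
  have := deg_t (F := F)
  rw [h, deg_zero] at this
  exact WithBot.bot_ne_coe this

theorem commute_t (x : RatFun F) : Commute (t F) x := by
  obtain ⟨p, q, rfl⟩ := exists_oreDiv x
  have hc : ∀ r : F[X], Commute (t F) (ofPoly r) := fun r => (commute_X r).map ofPoly
  have hmul := ofPoly_mul_oreDiv p q
  have hq : (ofPoly (q : F[X]) : RatFun F) ≠ 0 := by
    intro h
    have := deg_ofPoly (q : F[X]) (nonZeroDivisors.coe_ne_zero q)
    rw [h, deg_zero] at this
    exact WithBot.bot_ne_coe this
  rw [← eq_inv_mul_iff_mul_eq₀ hq] at hmul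
  refine (congrArg (Commute (t F)) hmul).mpr ?_
  exact (hc q).inv_right₀.mul_right (hc p)

theorem exists_deg_eq {x : RatFun F} (hx : x ≠ 0) : ∃ d : ℤ, deg x = d := by
  have h := deg_mul x x⁻¹
  rw [mul_inv_cancel₀ hx, deg_one] at h
  cases hd : deg x with
  | bot =>
    rw [hd, WithBot.bot_add] at h
    exact absurd h.symm WithBot.bot_ne_coe
  | coe d => exact ⟨d, rfl⟩

theorem deg_inv {x : RatFun F} {d : ℤ} (hd : deg x = d) : deg x⁻¹ = ((-d : ℤ) : WithBot ℤ) := by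
  have hx : x ≠ 0 := by
    rintro rfl
    rw [deg_zero] at hd
    exact WithBot.bot_ne_coe hd
  obtain ⟨d', hd'⟩ := exists_deg_eq (inv_ne_zero hx)
  have h := deg_mul x x⁻¹
  rw [mul_inv_cancel₀ hx, deg_one, hd, hd', ← WithBot.coe_add, ← WithBot.coe_zero,
    WithBot.coe_inj] at h
  rw [hd', WithBot.coe_inj]
  omega

theorem deg_t_pow (k : ℕ) : deg (t F ^ k) = ((k : ℤ) : WithBot ℤ) := by
  rw [t, ← map_pow, deg_ofPoly _ (pow_ne_zero k X_ne_zero), natDegree_X_pow]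

theorem deg_t_zpow (k : ℤ) : deg (t F ^ k) = (k : WithBot ℤ) := by
  obtain ⟨m, rfl | rfl⟩ := k.eq_nat_or_neg
  · rw [zpow_natCast, deg_t_pow]
  · rw [zpow_neg, zpow_natCast, deg_inv (deg_t_pow m)]

theorem mem_proper {x : RatFun F} : x ∈ proper F ↔ deg x ≤ 0 := Iff.rfl

/-- `F(t)⁻` is a discrete valuation ring with central uniformizer `t⁻¹`. -/
theorem isCentralPole_t : IsCentralPole (proper F) (t F) where
  commute := commute_t
  inv_mem := by
    rw [mem_proper, deg_inv (d := 1) deg_t]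
    exact WithBot.coe_le_coe.2 (by norm_num)
  notMem := by
    rw [mem_proper, deg_t, not_le]
    exact WithBot.coe_lt_coe.2 (by norm_num)
  exists_unit x hx := by
    obtain ⟨d, hd⟩ := exists_deg_eq hx
    have h0 : deg (x * t F ^ (-d)) = ((0 : ℤ) : WithBot ℤ) := by
      rw [deg_mul, hd, deg_t_zpow, ← WithBot.coe_add, add_neg_cancel]
    refine ⟨-d, h0.le, ?_⟩
    rw [mem_proper, deg_inv h0, neg_zero]
    rfl

theorem deg_le_of_inv_pow_mul_mem {x : RatFun F} {k : ℕ} (hx : (t F)⁻¹ ^ k * x ∈ proper F) :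
    deg x ≤ ((k : ℤ) : WithBot ℤ) := by
  have h1 : x = t F ^ k * ((t F)⁻¹ ^ k * x) := by
    rw [inv_pow, mul_inv_cancel_left₀ (pow_ne_zero k t_ne_zero)]
  rw [h1, deg_mul, deg_t_pow]
  exact add_le_of_nonpos_right hx

end RatFun

/-! ### The product of the lattices of row and column submodules -/

/-- The standard basis of the right vector space of column vectors, which is a left vector space
over the opposite skew field; its coordinates are `op (v i)`. -/
noncomputable def colBasis (F : Type*) [DivisionRing F] (n : ℕ) :
    Module.Basis (Fin n) (RatFun F)ᵐᵒᵖ (Fin n → RatFun F) :=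
  Module.Basis.ofEquivFun
    { toFun := fun v i => MulOpposite.op (v i)
      invFun := fun w i => (w i).unop
      map_add' := fun _ _ => rfl
      map_smul' := fun _ _ => rfl
      left_inv := fun _ => rfl
      right_inv := fun _ => rfl }

/-- The standard basis of the left vector space of row vectors. -/
noncomputable abbrev rowBasis (F : Type*) [DivisionRing F] (n : ℕ) :
    Module.Basis (Fin n) (RatFun F) (Fin n → RatFun F) :=
  Pi.basisFun (RatFun F) (Fin n)

/-- The ascending operator `(L, M) ↦ (t L, t⁻¹ M)`. -/
noncomputable def ascentIso (F : Type*) [DivisionRing F] (n : ℕ) :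
    LatL F n × (LatR F n)ᵒᵈ ≃o LatL F n × (LatR F n)ᵒᵈ where
  toFun p := (scaleIso isCentralPole_t (rowBasis F n) p.1,
    OrderDual.toDual ((scaleIso isCentralPole_t.op (colBasis F n)).symm (OrderDual.ofDual p.2)))
  invFun p := ((scaleIso isCentralPole_t (rowBasis F n)).symm p.1,
    OrderDual.toDual (scaleIso isCentralPole_t.op (colBasis F n) (OrderDual.ofDual p.2)))
  left_inv p := Prod.ext ((scaleIso isCentralPole_t (rowBasis F n)).symm_apply_apply p.1)
    ((scaleIso isCentralPole_t.op (colBasis F n)).apply_symm_apply (OrderDual.ofDual p.2))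
  right_inv p := Prod.ext ((scaleIso isCentralPole_t (rowBasis F n)).apply_symm_apply p.1)
    ((scaleIso isCentralPole_t.op (colBasis F n)).symm_apply_apply (OrderDual.ofDual p.2))
  map_rel_iff' {p q} := and_congr (OrderIso.le_iff_le _)
    ((scaleIso isCentralPole_t.op (colBasis F n)).symm.le_iff_le
      (x := OrderDual.ofDual q.2) (y := OrderDual.ofDual p.2))

theorem isAscent_ascentIso (x : LatL F n × (LatR F n)ᵒᵈ) : IsAscent x (ascentIso F n x) :=
  isAscent_prod (isLUB_covBy isCentralPole_t (rowBasis F n) x.1)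
    (isAscent_toDual (P := LatR F n)
      (isGLB_covBy isCentralPole_t.op (colBasis F n) (OrderDual.ofDual x.2)))
    (le_scaleIso _ _ _)
    (show OrderDual.ofDual (ascentIso F n x).2 ≤ OrderDual.ofDual x.2 from
      scaleIso_symm_le isCentralPole_t.op (colBasis F n) (OrderDual.ofDual x.2))

theorem coe_ascentIso_snd (x : LatL F n × (LatR F n)ᵒᵈ) :
    ((OrderDual.ofDual (ascentIso F n x).2).1 : Set (Fin n → RatFun F)) =
      (fun v => (t F)⁻¹ • v) '' ((OrderDual.ofDual x.2).1 : Set (Fin n → RatFun F)) := by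
  refine (coe_scaleIso_symm isCentralPole_t.op (colBasis F n) (OrderDual.ofDual x.2)).trans ?_
  refine Set.image_congr fun v _ => funext fun i => ?_
  -- The right action of `t⁻¹` agrees with the left one because `t` is central.
  exact ((commute_t (v i)).inv_left₀).eq.symm

theorem isAscent_iff (x y : LatL F n × (LatR F n)ᵒᵈ) : IsAscent x y ↔
    (y.1.1 : Set (Fin n → RatFun F)) =
        (fun v => t F • v) '' (x.1.1 : Set (Fin n → RatFun F)) ∧
      ((OrderDual.ofDual y.2).1 : Set (Fin n → RatFun F)) =
        (fun v => (t F)⁻¹ • v) '' ((OrderDual.ofDual x.2).1 : Set (Fin n → RatFun F)) := by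
  constructor
  · intro h
    rw [h.unique (isAscent_ascentIso x)]
    exact ⟨rfl, coe_ascentIso_snd x⟩
  · rintro ⟨h1, h2⟩
    have : y = ascentIso F n x := Prod.ext (Subtype.ext (SetLike.coe_injective h1))
      (Subtype.ext (SetLike.coe_injective (h2.trans (coe_ascentIso_snd x).symm)))
    rw [this]
    exact isAscent_ascentIso x

theorem isUniformModularLattice_latL_latR :
    IsUniformModularLattice (LatL F n × (LatR F n)ᵒᵈ) := by
  let := latticeFreeLat isCentralPole_t (rowBasis F n)
  let := latticeFreeLat isCentralPole_t.op (colBasis F n)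
  have := isModularLattice_freeLat isCentralPole_t (rowBasis F n)
  have := isModularLattice_freeLat isCentralPole_t.op (colBasis F n)
  exact isUniformModularLattice_prod_dual (strictMono_sum_pivot isCentralPole_t (rowBasis F n))
    (strictMono_sum_pivot isCentralPole_t.op (colBasis F n)) (ascentIso F n) isAscent_ascentIso

/-! ### The degree of a matrix on a pair of lattices -/

theorem _root_.WithBot.exists_isGreatest_int {S : Set (WithBot ℤ)} (hS : S.Nonempty) {K : ℤ}
    (hK : ∀ s ∈ S, s ≤ K) : ∃ m, IsGreatest S m := by
  by_cases h : ∃ z : ℤ, (z : WithBot ℤ) ∈ S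
  · obtain ⟨m, hm, hmax⟩ := Int.exists_greatest_of_bdd
      ⟨K, fun z hz => WithBot.coe_le_coe.1 (hK z hz)⟩ h
    refine ⟨m, hm, fun s hs => ?_⟩
    cases s with
    | bot => exact bot_le
    | coe z => exact WithBot.coe_le_coe.2 (hmax z hs)
  · have hbot : ∀ s ∈ S, s = ⊥ := by
      intro s hs
      cases s with
      | bot => rfl
      | coe z => exact absurd ⟨z, hs⟩ h
    obtain ⟨s, hs⟩ := hS
    exact ⟨s, hs, fun r hr => (hbot r hr).le.trans bot_le⟩

theorem inv_pow_mul_dotProduct_mulVec_mem {A : Matrix (Fin n) (Fin n) (RatFun F)}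
    {x y : Fin n → RatFun F} {k l m : ℕ} (hx : ∀ i, (t F)⁻¹ ^ k * x i ∈ proper F)
    (hA : ∀ i j, (t F)⁻¹ ^ l * A i j ∈ proper F) (hy : ∀ j, (t F)⁻¹ ^ m * y j ∈ proper F) :
    (t F)⁻¹ ^ (k + (l + m)) * (x ⬝ᵥ A.mulVec y) ∈ proper F := by
  rw [dotProduct, Finset.mul_sum]
  refine (proper F).sum_mem fun i _ => isCentralPole_t.inv_pow_add_mul_mem (hx i) ?_
  rw [Matrix.mulVec, dotProduct, Finset.mul_sum]
  exact (proper F).sum_mem fun j _ => isCentralPole_t.inv_pow_add_mul_mem (hA i j) (hy j)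

theorem zero_mem_valueSet (A : Matrix (Fin n) (Fin n) (RatFun F)) (L : LatL F n) (M : LatR F n) :
    0 ∈ valueSet A L M :=
  ⟨0, L.1.zero_mem, 0, M.1.zero_mem, by simp⟩

theorem isGreatest_degOn (A : Matrix (Fin n) (Fin n) (RatFun F)) (L : LatL F n) (M : LatR F n) :
    IsGreatest (deg '' valueSet A L M) (degOn A L M) := by
  obtain ⟨k, hk⟩ := (isFullBounded isCentralPole_t (rowBasis F n) L).bounded
  obtain ⟨l, hl⟩ := isCentralPole_t.exists_inv_pow_mul_mem_forall
    fun p : Fin n × Fin n => A p.1 p.2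
  obtain ⟨m, hm⟩ := (isFullBounded isCentralPole_t.op (colBasis F n) M).bounded
  obtain ⟨d, hd⟩ := WithBot.exists_isGreatest_int (S := deg '' valueSet A L M)
    ⟨_, 0, zero_mem_valueSet A L M, rfl⟩ (K := ((k + (l + m) : ℕ) : ℤ)) (by
      rintro _ ⟨_, ⟨x, hx, y, hy, rfl⟩, rfl⟩
      refine deg_le_of_inv_pow_mul_mem (inv_pow_mul_dotProduct_mulVec_mem (hk x hx)
        (fun i j => hl (i, j)) fun j => ?_)
      have : y j * (t F)⁻¹ ^ m ∈ proper F := hm y hy j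
      rwa [← (isCentralPole_t.inv_pow_commute m (y j)).eq] at this)
  rwa [degOn, hd.csSup_eq]

theorem degOn_le_zero_iff {A : Matrix (Fin n) (Fin n) (RatFun F)} {L : LatL F n}
    {M : LatR F n} :
    degOn A L M ≤ 0 ↔ ∀ x ∈ L.1, ∀ y ∈ M.1, x ⬝ᵥ A.mulVec y ∈ proper F := by
  constructor
  · exact fun h x hx y hy =>
      ((isGreatest_degOn A L M).2 ⟨_, ⟨x, hx, y, hy, rfl⟩, rfl⟩).trans h
  · intro h
    obtain ⟨_, ⟨x, hx, y, hy, rfl⟩, hu⟩ := (isGreatest_degOn A L M).1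
    exact hu ▸ h x hx y hy

theorem inftyMul_of_le {c : WithBot ℤ} (hc : c ≤ 0) : inftyMul c = 0 := if_neg hc.not_gt

theorem inftyMul_of_lt {c : WithBot ℤ} (hc : 0 < c) : inftyMul c = ⊤ := if_pos hc

theorem exists_degOn_le_zero (A : Matrix (Fin n) (Fin n) (RatFun F)) :
    ∃ (L : LatL F n) (M : LatR F n), degOn A L M ≤ 0 := by
  obtain ⟨k, hk⟩ := isCentralPole_t.exists_inv_pow_mul_mem_forall
    fun p : Fin n × Fin n => A p.1 p.2
  obtain ⟨L, hL⟩ := exists_freeLat isCentralPole_t (rowBasis F n) k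
  obtain ⟨M, hM⟩ := exists_freeLat isCentralPole_t.op (colBasis F n) 0
  refine ⟨L, M, degOn_le_zero_iff.2 fun x hx y hy => ?_⟩
  refine (proper F).sum_mem fun i _ => ?_
  have hAy : (t F)⁻¹ ^ k * A.mulVec y i ∈ proper F := by
    rw [Matrix.mulVec, dotProduct, Finset.mul_sum]
    refine (proper F).sum_mem fun j _ => ?_
    rw [← mul_assoc]
    refine (proper F).mul_mem (hk (i, j)) ?_
    have : t F ^ 0 * y j ∈ proper F := hM y hy j
    simpa using this
  have := (proper F).mul_mem (hL x hx i) hAy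
  rwa [inv_pow, ← mul_assoc, mul_inv_cancel_right₀ (pow_ne_zero k t_ne_zero)] at this

theorem degOn_eq_of_isAscent (A : Matrix (Fin n) (Fin n) (RatFun F))
    {x y : LatL F n × (LatR F n)ᵒᵈ} (h : IsAscent x y) :
    degOn A y.1 (OrderDual.ofDual y.2) = degOn A x.1 (OrderDual.ofDual x.2) := by
  obtain ⟨h1, h2⟩ := (isAscent_iff x y).1 h
  have hval : ∀ v w : Fin n → RatFun F,
      (t F • v) ⬝ᵥ A.mulVec ((t F)⁻¹ • w) = v ⬝ᵥ A.mulVec w := by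
    intro v w
    simp only [dotProduct, Matrix.mulVec, Pi.smul_apply, smul_eq_mul]
    refine Finset.sum_congr rfl fun i _ => ?_
    rw [(commute_t (v i)).eq, mul_assoc, Finset.mul_sum]
    congr 1
    refine Finset.sum_congr rfl fun j _ => ?_
    rw [← mul_assoc (A i j), ← ((commute_t (A i j)).inv_left₀).eq, mul_assoc,
      mul_inv_cancel_left₀ t_ne_zero]
  have hset : valueSet A y.1 (OrderDual.ofDual y.2) = valueSet A x.1 (OrderDual.ofDual x.2) := by
    ext u
    constructor
    · rintro ⟨v, hv, w, hw, rfl⟩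
      rw [← SetLike.mem_coe, h1] at hv
      rw [← SetLike.mem_coe, h2] at hw
      obtain ⟨v, hv, rfl⟩ := hv
      obtain ⟨w, hw, rfl⟩ := hw
      exact ⟨v, hv, w, hw, hval v w⟩
    · rintro ⟨v, hv, w, hw, rfl⟩
      refine ⟨t F • v, ?_, (t F)⁻¹ • w, ?_, (hval v w).symm⟩
      · rw [← SetLike.mem_coe, h1]
        exact ⟨v, hv, rfl⟩
      · rw [← SetLike.mem_coe, h2]
        exact ⟨w, hw, rfl⟩
  rw [degOn, hset, degOn]

/-- If `A` takes proper values on `(L, M)` and `(L', M')`, then by additivity also on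
`(L ∩ L', M + M')` and `(L + L', M ∩ M')`. -/
theorem degOn_meet_join_le_zero (A : Matrix (Fin n) (Fin n) (RatFun F))
    {x y m j : LatL F n × (LatR F n)ᵒᵈ} (hm : IsGLB {x, y} m) (hj : IsLUB {x, y} j)
    (hx : degOn A x.1 (OrderDual.ofDual x.2) ≤ 0) (hy : degOn A y.1 (OrderDual.ofDual y.2) ≤ 0) :
    degOn A m.1 (OrderDual.ofDual m.2) ≤ 0 ∧ degOn A j.1 (OrderDual.ofDual j.2) ≤ 0 := by
  let := latticeFreeLat isCentralPole_t (rowBasis F n)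
  let := latticeFreeLat isCentralPole_t.op (colBasis F n)
  rw [degOn_le_zero_iff] at hx hy
  have hm' : m = x ⊓ y := hm.unique isGLB_pair
  have hj' : j = x ⊔ y := hj.unique isLUB_pair
  subst hm' hj'
  constructor
  · refine degOn_le_zero_iff.2 fun v hv w hw => ?_
    obtain ⟨w₁, hw₁, w₂, hw₂, rfl⟩ := Submodule.mem_sup.1
      (show w ∈ (OrderDual.ofDual x.2).1 ⊔ (OrderDual.ofDual y.2).1 from hw)
    have hv' : v ∈ x.1.1 ⊓ y.1.1 := hv
    rw [Matrix.mulVec_add, dotProduct_add]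
    exact (proper F).add_mem (hx v hv'.1 w₁ hw₁) (hy v hv'.2 w₂ hw₂)
  · refine degOn_le_zero_iff.2 fun v hv w hw => ?_
    obtain ⟨v₁, hv₁, v₂, hv₂, rfl⟩ := Submodule.mem_sup.1 (show v ∈ x.1.1 ⊔ y.1.1 from hv)
    have hw' : w ∈ (OrderDual.ofDual x.2).1 ⊓ (OrderDual.ofDual y.2).1 := hw
    rw [add_dotProduct]
    exact (proper F).add_mem (hx v₁ hv₁ w hw'.1) (hy v₂ hv₂ w hw'.2)

theorem isLConvex_inftyMul_degOn (A : Matrix (Fin n) (Fin n) (RatFun F)) :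
    IsLConvex (fun x : LatL F n × (LatR F n)ᵒᵈ =>
      inftyMul (degOn A x.1 (OrderDual.ofDual x.2))) where
  exists_lt_top := by
    obtain ⟨L, M, h⟩ := exists_degOn_le_zero A
    refine ⟨(L, OrderDual.toDual M), ?_⟩
    dsimp only
    rw [OrderDual.ofDual_toDual, inftyMul_of_le h]
    exact WithTop.coe_lt_top 0
  sub x y m j hm hj := by
    rcases lt_or_ge 0 (degOn A x.1 (OrderDual.ofDual x.2)) with hx | hx
    · simp [inftyMul_of_lt hx]
    rcases lt_or_ge 0 (degOn A y.1 (OrderDual.ofDual y.2)) with hy | hy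
    · simp [inftyMul_of_lt hy]
    obtain ⟨h1, h2⟩ := degOn_meet_join_le_zero A hm hj hx hy
    simp [inftyMul_of_le, hx, hy, h1, h2]
  lin := ⟨0, fun x y h => by simp [degOn_eq_of_isAscent A h]⟩

end SkewRat

theorem lemma3p7 {F : Type*} [DivisionRing F] (n : ℕ)
    (A : Matrix (Fin n) (Fin n) (SkewRat.RatFun F)) :
    SkewRat.IsUniformModularLattice (SkewRat.LatL F n × (SkewRat.LatR F n)ᵒᵈ) ∧
    (∀ x y : SkewRat.LatL F n × (SkewRat.LatR F n)ᵒᵈ, SkewRat.IsAscent x y ↔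
      (y.1.1 : Set (Fin n → SkewRat.RatFun F)) =
          (fun v => SkewRat.RatFun.t F • v) '' (x.1.1 : Set (Fin n → SkewRat.RatFun F)) ∧
        ((OrderDual.ofDual y.2).1 : Set (Fin n → SkewRat.RatFun F)) =
          (fun v => (SkewRat.RatFun.t F)⁻¹ • v) ''
            ((OrderDual.ofDual x.2).1 : Set (Fin n → SkewRat.RatFun F))) ∧
    (∀ (L : SkewRat.LatL F n) (M : SkewRat.LatR F n),
      IsGreatest (SkewRat.RatFun.deg '' SkewRat.valueSet A L M) (SkewRat.degOn A L M)) ∧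
    SkewRat.IsLConvex (fun x : SkewRat.LatL F n × (SkewRat.LatR F n)ᵒᵈ =>
      SkewRat.inftyMul (SkewRat.degOn A x.1 (OrderDual.ofDual x.2))) :=
  ⟨SkewRat.isUniformModularLattice_latL_latR, SkewRat.isAscent_iff, SkewRat.isGreatest_degOn A,
    SkewRat.isLConvex_inftyMul_degOn A⟩
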